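/- For integers $r,s,k\ge 0$ let $N_{\rm bi}(r,s,k)$ be the number of labelled connected bipartite graphs with Betti number $k$ on a vertex set $V_1\sqcup V_2$ with $|V_1|=r$, $|V_2|=s$, i.e. the number of connected spanning subgraphs of the complete bipartite graph $K_{r,s}$ with exactly $r+s+k-1$ edges (the one-vertex graph counts as connected and the empty graph does not, so $N_{\rm bi}(1,0,0)=N_{\rm bi}(0,1,0)=1$ and $N_{\rm bi}(0,0,k)=0$). Let $$F_k(x,y)=\sum_{r,s\ge 0}\frac{N_{\rm bi}(r,s,k)}{r!\,s!}\,x^r y^s\in\mathbb{Q}[[x,y]]$$ be the exponential generating function of these numbers. Put $T=F_0$ (the exponential generating function of the spanning trees of the graphs $K_{r,s}$), $T_x=x\,\partial T/\partial x$, $T_y=y\,\partial T/\partial y$ and $W=T_xT_y$. **Proposition.** The series $W$ has zero constant term, and the exponential generating function $F_1$ of the unicycles in the graphs $K_{r,s}$ is given by $F_1=f_1(W)$, where $f_1(w)=-\frac12\bigl(\log(1-w)+w\bigr)$; that is, as an identity of formal power series, $$F_1(x,y)=-\frac12\Bigl(\log(1-T_xT_y)+T_xT_y\Bigr).$$ 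-/

import Mathlib

/-- The number of labelled connected bipartite graphs with ordered bipartition of sizes `r` and `s`
and with Betti number `k`, i.e. of connected spanning subgraphs of `K_{r,s}` with `r + s + k - 1`
edges (written without truncated subtraction). For `r = s = 0` there is none, as a connected graph
is nonempty. -/
noncomputable def numConnBipartite (r s k : ℕ) : ℕ :=
  Set.ncard {G : SimpleGraph (Fin r ⊕ Fin s) |
    G ≤ completeBipartiteGraph (Fin r) (Fin s) ∧ G.Connected ∧ G.edgeSet.ncard + 1 = r + s + k}

/-- The exponential generating function `F_k(x, y) = ∑ N(r, s, k) x^r y^s / (r! s!)`, as a formal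
power series in the variables `x = X 0` and `y = X 1`. -/
noncomputable def bipartiteEGF (k : ℕ) : MvPowerSeries (Fin 2) ℚ := fun d =>
  (numConnBipartite (d 0) (d 1) k : ℚ) / ((Nat.factorial (d 0) : ℚ) * (Nat.factorial (d 1) : ℚ))

/-- The exponential generating function `T = F_0` of the spanning trees of the `K_{r,s}`. -/
noncomputable def treeEGF : MvPowerSeries (Fin 2) ℚ := bipartiteEGF 0

/-- The Euler operator `X_i ∂/∂X_i` on formal power series in `x = X 0` and `y = X 1`. -/
noncomputable def eulerOp (i : Fin 2) (f : MvPowerSeries (Fin 2) ℚ) : MvPowerSeries (Fin 2) ℚ :=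
  MvPowerSeries.X i * MvPowerSeries.pderiv ℚ i f

/-- `T_x = x ∂T/∂x`. -/
noncomputable def treeEGFx : MvPowerSeries (Fin 2) ℚ := eulerOp 0 treeEGF

/-- `T_y = y ∂T/∂y`. -/
noncomputable def treeEGFy : MvPowerSeries (Fin 2) ℚ := eulerOp 1 treeEGF

/-- `W = T_x T_y`. -/
noncomputable def treeEGFW : MvPowerSeries (Fin 2) ℚ := treeEGFx * treeEGFy

/-- The logarithm of a two-variable formal power series `f` with constant coefficient `1`:
the series `log (1 + t) = ∑_{n ≥ 1} (-1)^(n+1) t^n / n` evaluated at `t = f - 1`. -/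
noncomputable def mvLog (f : MvPowerSeries (Fin 2) ℚ) : MvPowerSeries (Fin 2) ℚ :=
  PowerSeries.subst (f - 1) (PowerSeries.log ℚ)

/-- The one-variable formal power series `f₁(w) = -(1/2) (log (1 - w) + w)`. -/
noncomputable def unicycleSeries : PowerSeries ℚ :=
  (-(1 / 2) : ℚ) • (PowerSeries.logOf (1 - PowerSeries.X) + PowerSeries.X)

open Finset.HasAntidiagonal (antidiagonal mem_antidiagonal)

/-! Write θx, θy for the Euler operators, a = T_x, b = T_y, t = θxθyT and W = ab.

Count in two ways the connected properly coloured graphs with a marked edge. Removing the marked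
edge leaves either a connected graph with Betti number one less, or two connected pieces, one at
each end of the edge, whose Betti numbers add up to the old one (`ncard_connectedColored_mul`). In
generating functions this reads a + b − T = ab for trees (`tree_equation`) and (1 − b)θxF₁ + (1 −
a)θyF₁ = t − W for unicycles (`unicycle_equation` combined with `tree_equation`).

Put D = (1 − b)θx + (1 − a)θy. Differentiating the tree equation gives Da = a and Db = b, hence DW =
2W. Differentiating once more gives a Riccati equation for Dt, which identifies t = W/(1 − W)
(`mixed_derivative_equation`). Then DF₁ = t − W = W²/(1 − W), while f₁'(w) = w/(2(1 − w)) gives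
D(f₁(W)) = f₁'(W)·2W, the same series. In lowest degree D acts as multiplication by the degree, so
equal constant terms force F₁ = f₁(W); both this and the identification of t rest on
`eq_zero_of_eulerOp_eq`. -/

theorem Set.ncard_eq_sum_ncard_fiber {α ι : Type*} [Finite α] (S : Set α) (f : α → ι)
    (t : Finset ι) (h : ∀ x ∈ S, f x ∈ t) :
    S.ncard = ∑ i ∈ t, {x | x ∈ S ∧ f x = i}.ncard := by
  classical
  rw [Set.ncard_eq_toFinset_card S, Finset.card_eq_sum_card_fiberwise (f := f) (t := t)]
  · refine Finset.sum_congr rfl fun i _ => ?_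
    rw [Set.ncard_eq_toFinset_card]
    congr 1
    ext x
    simp
  · intro x hx
    exact h x (by simpa using hx)

theorem Set.ncard_setOf_prod_eq_mul {α β : Type*} [Finite α] [Finite β] (A : Set α)
    (B : α → Set β) (n : ℕ) (h : ∀ a ∈ A, (B a).ncard = n) :
    {p : α × β | p.1 ∈ A ∧ p.2 ∈ B p.1}.ncard = A.ncard * n := by
  classical
  rw [Set.ncard_eq_sum_ncard_fiber _ Prod.fst A.toFinite.toFinset (by simp; tauto),
    Set.ncard_eq_toFinset_card A, ← smul_eq_mul, ← Finset.sum_const]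
  refine Finset.sum_congr rfl fun a ha => ?_
  have ha' : a ∈ A := by simpa using ha
  rw [← h a ha', ← Set.ncard_image_of_injective (B a) (Prod.mk_right_injective a)]
  congr 1
  ext ⟨x, y⟩
  simp only [Set.mem_ofPred_eq, Set.mem_image, Prod.mk.injEq]
  constructor
  · rintro ⟨⟨-, hy⟩, rfl⟩
    exact ⟨y, hy, rfl, rfl⟩
  · rintro ⟨y, hy, rfl, rfl⟩
    exact ⟨⟨ha', hy⟩, rfl⟩

/-! ### Coloured graphs and removal of a marked edge -/

namespace SimpleGraph

variable {V W : Type*}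

/-- The colouring `c : V → Bool` of the graph `G` is proper. -/
def ProperlyColoredBy (G : SimpleGraph V) (c : V → Bool) : Prop :=
  ∀ a b, G.Adj a b → c a ≠ c b

/-- The connected graphs with Betti number `k` that are properly coloured by `c`. -/
def connectedColored (c : V → Bool) (k : ℕ) : Set (SimpleGraph V) :=
  {G | G.ProperlyColoredBy c ∧ G.Connected ∧ G.edgeSet.ncard + 1 = Nat.card V + k}

theorem ncard_edgeSet_congr {G : SimpleGraph V} {H : SimpleGraph W} (e : G ≃g H) :
    G.edgeSet.ncard = H.edgeSet.ncard := by
  rw [← Nat.card_coe_set_eq, ← Nat.card_coe_set_eq, Nat.card_congr e.mapEdgeSet]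

theorem ncard_edgeSet_sum [Finite V] [Finite W] (G : SimpleGraph V) (H : SimpleGraph W) :
    (G ⊕g H).edgeSet.ncard = G.edgeSet.ncard + H.edgeSet.ncard := by
  simp only [← Nat.card_coe_set_eq]
  rw [Nat.card_congr edgeSetSumEquiv, Nat.card_sum]

theorem ncard_connectedColored_congr (e : V ≃ W) {c : V → Bool} {d : W → Bool}
    (h : ∀ v, d (e v) = c v) (k : ℕ) :
    (connectedColored c k).ncard = (connectedColored d k).ncard := by
  rw [← Nat.card_coe_set_eq, ← Nat.card_coe_set_eq]
  refine Nat.card_congr (e.simpleGraph.symm.subtypeEquiv fun G => ?_).symm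
  let i : G.comap e ≃g G := Iso.comap e G
  change _ ↔ (G.comap e) ∈ connectedColored c k
  simp only [connectedColored, Set.mem_ofPred_eq]
  rw [i.connected_iff, ncard_edgeSet_congr i, Nat.card_congr e]
  refine and_congr_left fun _ => ?_
  constructor
  · intro hG a b hab
    rw [← h, ← h]
    exact hG _ _ hab
  · intro hG a b hab
    have := hG (e.symm a) (e.symm b) (by simpa using hab)
    simpa [← h] using this

/-- A proper colouring orients every edge in exactly one way from `true` to `false`, so edges can be
handled as ordered pairs without factors of 2. -/
theorem ProperlyColoredBy.ncard_edgeSet {c : V → Bool} {G : SimpleGraph V}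
    (h : G.ProperlyColoredBy c) :
    {q : V × V | c q.1 = true ∧ c q.2 = false ∧ G.Adj q.1 q.2}.ncard = G.edgeSet.ncard := by
  refine Set.ncard_congr (fun q _ => s(q.1, q.2)) (fun q hq => hq.2.2) ?_ ?_
  · rintro ⟨a, b⟩ ⟨a', b'⟩ ⟨h1, h2, -⟩ ⟨h3, h4, -⟩ he
    simp only [Sym2.eq_iff] at he
    grind
  · intro e
    induction e with
    | h a b =>
      intro hab
      have hc := h a b hab
      rcases ha : c a with _ | _
      · exact ⟨(b, a), ⟨by grind, ha, hab.symm⟩, Sym2.eq_swap⟩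
      · exact ⟨(a, b), ⟨ha, by grind, hab⟩, rfl⟩

theorem ProperlyColoredBy.sup_edge {c : V → Bool} {H : SimpleGraph V}
    (h : H.ProperlyColoredBy c) {u v : V} (hu : c u = true) (hv : c v = false) :
    (H ⊔ edge u v).ProperlyColoredBy c := by
  intro a b hab
  rw [sup_adj, edge_adj] at hab
  rcases hab with hab | ⟨⟨rfl, rfl⟩ | ⟨rfl, rfl⟩, -⟩
  · exact h a b hab
  · simp [hu, hv]
  · simp [hu, hv]

theorem ncard_edgeSet_sup_edge [Finite V] {H : SimpleGraph V} {u v : V} (huv : u ≠ v)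
    (h : ¬ H.Adj u v) : (H ⊔ edge u v).edgeSet.ncard = H.edgeSet.ncard + 1 := by
  rw [edgeSet_sup, edgeSet_edge_of_ne huv, Set.union_singleton,
    Set.ncard_insert_of_notMem (by simpa using h)]

/-- The graphs with `m` edges that are properly coloured by `c`, together with a missing edge
from a vertex of colour `true` to a vertex of colour `false` whose addition makes the graph
connected. -/
def connectingPairs (c : V → Bool) (m : ℕ) : Set (SimpleGraph V × (V × V)) :=
  {p | p.1.ProperlyColoredBy c ∧ p.1.edgeSet.ncard = m ∧ c p.2.1 = true ∧ c p.2.2 = false ∧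
    ¬ p.1.Adj p.2.1 p.2.2 ∧ (p.1 ⊔ edge p.2.1 p.2.2).Connected}

/-- Adding the missing edge and remembering it is a bijection onto connected graphs with a marked
edge; each such graph has `m + 1` edges to mark. -/
theorem ncard_connectingPairs [Finite V] (c : V → Bool) {k m : ℕ} (hm : m + 2 = Nat.card V + k) :
    (connectingPairs c m).ncard = (connectedColored c k).ncard * (m + 1) := by
  rw [← Set.ncard_setOf_prod_eq_mul (connectedColored c k)
    (fun G => {q : V × V | c q.1 = true ∧ c q.2 = false ∧ G.Adj q.1 q.2}) (m + 1)
    (fun G hG => by rw [hG.1.ncard_edgeSet]; have := hG.2.2; omega)]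
  refine Set.ncard_congr (fun p _ => (p.1 ⊔ edge p.2.1 p.2.2, p.2)) ?_ ?_ ?_
  · rintro ⟨H, u, v⟩ ⟨h1, h2, hu, hv, h5, h6⟩
    have huv : u ≠ v := by rintro rfl; simp_all
    refine ⟨⟨h1.sup_edge hu hv, h6, ?_⟩, hu, hv, ?_⟩
    · dsimp only at *
      rw [ncard_edgeSet_sup_edge huv h5]
      omega
    · simp [edge_adj, huv]
  · rintro ⟨H, u, v⟩ ⟨H', u', v'⟩ ⟨-, -, -, -, h5, -⟩ ⟨-, -, -, -, h5', -⟩ he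
    simp only [Prod.mk.injEq] at he
    obtain ⟨he, rfl, rfl⟩ := he
    dsimp only at h5 h5'
    rw [← sdiff_edge _ h5, ← sup_sdiff_right_self, he, sup_sdiff_right_self, sdiff_edge _ h5']
  · rintro ⟨G, u, v⟩ ⟨⟨h1, h2, h3⟩, hu, hv, h⟩
    dsimp only at *
    have huv : u ≠ v := h.ne
    have hsup : G \ edge u v ⊔ edge u v = G := by
      rw [sdiff_sup_self, sup_eq_left, edge_le_iff]
      exact Or.inr h
    have hn : ¬ (G \ edge u v).Adj u v := by simp [edge_adj, huv]
    refine ⟨(G \ edge u v, u, v), ⟨fun a b hab => h1 a b hab.1, ?_, hu, hv, hn, ?_⟩, ?_⟩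
    · have := ncard_edgeSet_sup_edge huv hn
      rw [hsup] at this
      dsimp only
      omega
    · dsimp only; rwa [hsup]
    · simp only [hsup]

/-- Once the graph is connected, any missing edge between the two colour classes may be added. -/
theorem ncard_connectingPairs_connected [Finite V] (c : V → Bool) (m : ℕ) :
    {p ∈ connectingPairs c m | p.1.Connected}.ncard =
      {G : SimpleGraph V | G.ProperlyColoredBy c ∧ G.Connected ∧ G.edgeSet.ncard = m}.ncard *
        ({u | c u = true}.ncard * {v | c v = false}.ncard - m) := by
  rw [← Set.ncard_setOf_prod_eq_mul _
    (fun G => {q : V × V | c q.1 = true ∧ c q.2 = false ∧ ¬ G.Adj q.1 q.2}) _ ?_]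
  · congr 1
    ext ⟨G, u, v⟩
    simp only [connectingPairs, Set.mem_ofPred_eq]
    constructor
    · tauto
    · rintro ⟨⟨h1, h2, h3⟩, h4, h5, h6⟩
      exact ⟨⟨h1, h3, h4, h5, h6, h2.mono le_sup_left⟩, h2⟩
  · rintro G ⟨h1, -, h3⟩
    rw [← h3, ← h1.ncard_edgeSet, ← Set.ncard_prod, ← Set.ncard_sdiff]
    · congr 1
      ext ⟨u, v⟩
      simp only [Set.mem_ofPred_eq, Set.mem_sdiff, Set.mem_prod]
      tauto
    · rintro ⟨u, v⟩ ⟨h1, h2, -⟩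
      exact ⟨h1, h2⟩

/-! ### Graphs that split into two connected pieces -/

open Classical in
/-- The disjoint union of a graph on `S` and a graph on the complement of `S`. -/
noncomputable def glue {S : Set V} (G₁ : SimpleGraph S) (G₂ : SimpleGraph ↥Sᶜ) : SimpleGraph V :=
  (Equiv.Set.sumCompl S).simpleGraph (G₁ ⊕g G₂)

section glue

variable {S : Set V} {G₁ : SimpleGraph S} {G₂ : SimpleGraph ↥Sᶜ}

open Classical in
/-- `glue G₁ G₂` is isomorphic to the disjoint sum of `G₁` and `G₂`. -/
noncomputable def glueIso (G₁ : SimpleGraph S) (G₂ : SimpleGraph ↥Sᶜ) :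
    G₁ ⊕g G₂ ≃g glue G₁ G₂ :=
  (Iso.comap (Equiv.Set.sumCompl S).symm (G₁ ⊕g G₂)).symm

@[simp]
theorem glueIso_inl (x : S) : glueIso G₁ G₂ (.inl x) = x := rfl

@[simp]
theorem glueIso_inr (x : ↥Sᶜ) : glueIso G₁ G₂ (.inr x) = x := rfl

theorem glue_adj_left (x y : S) : (glue G₁ G₂).Adj x y ↔ G₁.Adj x y :=
  (glueIso G₁ G₂).map_adj_iff (v := .inl x) (w := .inl y)

theorem glue_adj_right (x y : ↥Sᶜ) : (glue G₁ G₂).Adj x y ↔ G₂.Adj x y :=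
  (glueIso G₁ G₂).map_adj_iff (v := .inr x) (w := .inr y)

theorem not_glue_reachable (x : S) (y : ↥Sᶜ) : ¬ (glue G₁ G₂).Reachable x y := by
  have := (glueIso G₁ G₂).reachable_iff (u := .inl x) (v := .inr y)
  rw [glueIso_inl, glueIso_inr] at this
  rw [this]
  exact not_reachable_sum_inl_inr x y

theorem glue_injective {G₁' : SimpleGraph S} {G₂' : SimpleGraph ↥Sᶜ}
    (h : glue G₁ G₂ = glue G₁' G₂') : G₁ = G₁' ∧ G₂ = G₂' := by
  constructor
  · ext x y
    rw [← glue_adj_left (G₂ := G₂), h, glue_adj_left]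
  · ext x y
    rw [← glue_adj_right (G₁ := G₁), h, glue_adj_right]

theorem glue_induce {H : SimpleGraph V} (h : ∀ x ∈ S, ∀ y ∉ S, ¬ H.Adj x y) :
    glue (H.induce S) (H.induce Sᶜ) = H := by
  ext a b
  by_cases ha : a ∈ S <;> by_cases hb : b ∈ S
  · exact glue_adj_left ⟨a, ha⟩ ⟨b, hb⟩
  · exact iff_of_false (fun h' => not_glue_reachable ⟨a, ha⟩ ⟨b, hb⟩ h'.reachable) (h a ha b hb)
  · exact iff_of_false (fun h' => not_glue_reachable ⟨b, hb⟩ ⟨a, ha⟩ h'.symm.reachable)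
      fun h' => h b hb a ha h'.symm
  · exact glue_adj_right ⟨a, ha⟩ ⟨b, hb⟩

theorem ncard_edgeSet_glue [Finite V] :
    (glue G₁ G₂).edgeSet.ncard = G₁.edgeSet.ncard + G₂.edgeSet.ncard := by
  rw [← ncard_edgeSet_congr (glueIso G₁ G₂), ncard_edgeSet_sum]

theorem ProperlyColoredBy.glue {c : V → Bool} (h₁ : G₁.ProperlyColoredBy fun x => c x)
    (h₂ : G₂.ProperlyColoredBy fun x => c x) :
    (SimpleGraph.glue G₁ G₂).ProperlyColoredBy c := by
  intro a b hab
  by_cases ha : a ∈ S <;> by_cases hb : b ∈ S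
  · exact h₁ ⟨a, ha⟩ ⟨b, hb⟩ ((glue_adj_left _ _).1 hab)
  · exact (not_glue_reachable ⟨a, ha⟩ ⟨b, hb⟩ hab.reachable).elim
  · exact (not_glue_reachable ⟨b, hb⟩ ⟨a, ha⟩ hab.symm.reachable).elim
  · exact h₂ ⟨a, ha⟩ ⟨b, hb⟩ ((glue_adj_right _ _).1 hab)

theorem Connected.glue_sup_edge (h₁ : G₁.Connected) (h₂ : G₂.Connected) (u : S) (v : ↥Sᶜ) :
    (glue G₁ G₂ ⊔ edge (u : V) (v : V)).Connected := by
  have h := h₁.sum_sup_edge h₂ (v := u) (w := v)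
  refine h.map ⟨glueIso G₁ G₂, ?_⟩ (glueIso G₁ G₂).surjective
  intro a b hab
  rw [sup_adj, edge_adj] at hab ⊢
  rcases hab with hab | ⟨⟨rfl, rfl⟩ | ⟨rfl, rfl⟩, -⟩
  · exact Or.inl ((glueIso G₁ G₂).map_adj_iff.2 hab)
  · exact Or.inr ⟨Or.inl ⟨rfl, rfl⟩, fun h : (u : V) = v => v.2 (h ▸ u.2)⟩
  · exact Or.inr ⟨Or.inr ⟨rfl, rfl⟩, fun h : (v : V) = u => v.2 (h ▸ u.2)⟩

theorem setOf_glue_reachable (h₁ : G₁.Connected) (u : S) :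
    {w | (glue G₁ G₂).Reachable u w} = S := by
  ext w
  constructor
  · intro h
    by_contra hw
    exact not_glue_reachable u ⟨w, hw⟩ h
  · intro hw
    exact (h₁ u ⟨w, hw⟩).map ⟨Subtype.val, fun {a b} h => (glue_adj_left a b).2 h⟩

end glue

/-- Follow a walk from `w` to `u`: up to its first use of the new edge it stays in `H`. -/
theorem reachable_or_of_sup_edge_connected {H : SimpleGraph V} {u v : V}
    (h : (H ⊔ edge u v).Connected) (w : V) : H.Reachable u w ∨ H.Reachable v w := by
  have key : ∀ {a b : V}, (H ⊔ edge u v).Walk a b → b = u → H.Reachable u a ∨ H.Reachable v a := by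
    intro a b p
    induction p with
    | nil => rintro rfl; exact Or.inl .rfl
    | cons hab p ih =>
      intro hb
      have ih := ih hb
      rw [sup_adj, edge_adj] at hab
      rcases hab with hab | ⟨⟨rfl, rfl⟩ | ⟨rfl, rfl⟩, -⟩
      · exact ih.imp (fun h => h.trans hab.symm.reachable) fun h => h.trans hab.symm.reachable
      · exact Or.inl .rfl
      · exact Or.inr .rfl
  obtain ⟨p⟩ := h.1 w u
  exact key p rfl

theorem connected_induce_setOf_reachable (H : SimpleGraph V) (u : V) :
    (H.induce {w | H.Reachable u w}).Connected := by
  have h : {w | H.Reachable u w} = (H.connectedComponentMk u).supp := by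
    ext w
    simp [reachable_comm]
  rw [h]
  exact ConnectedComponent.connected_toSimpleGraph _

/-- The pairs of connected properly coloured graphs on `S` and its complement with `m` edges in
total. -/
def connectedColoredPairs (c : V → Bool) (S : Set V) (m : ℕ) :
    Set (SimpleGraph S × SimpleGraph ↥Sᶜ) :=
  {q | (q.1.ProperlyColoredBy (fun x => c x) ∧ q.1.Connected) ∧
    (q.2.ProperlyColoredBy (fun x => c x) ∧ q.2.Connected) ∧
      q.1.edgeSet.ncard + q.2.edgeSet.ncard = m}

/-- If `S` is the component of `u`, then the component of `v` must be all of `Sᶜ`, so the graph is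
glued from two connected pieces, and `u`, `v` range freely over the vertices of the right colour.
Since `S` is singled out by the `true` endpoint, the pair of pieces is ordered and no factor 1/2
appears. -/
theorem ncard_connectingPairs_fiber [Finite V] (c : V → Bool) (S : Set V) (m : ℕ) :
    {p | p ∈ {p ∈ connectingPairs c m | ¬ p.1.Connected} ∧
        {w | p.1.Reachable p.2.1 w} = S}.ncard =
      (connectedColoredPairs c S m).ncard *
        ({u | u ∈ S ∧ c u = true}.ncard * {v | v ∈ Sᶜ ∧ c v = false}.ncard) := by
  rw [← Set.ncard_prod, ← Set.ncard_prod]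
  symm
  refine Set.ncard_congr (fun p _ => (glue p.1.1 p.1.2, p.2)) ?_ ?_ ?_
  · rintro ⟨⟨G₁, G₂⟩, u, v⟩ ⟨⟨⟨h1, h2⟩, ⟨h3, h4⟩, h5⟩, ⟨hu, hu'⟩, hv, hv'⟩
    dsimp only at *
    have hr := not_glue_reachable (G₁ := G₁) (G₂ := G₂) ⟨u, hu⟩ ⟨v, hv⟩
    refine ⟨⟨⟨h1.glue h3, ?_, hu', hv', fun h => hr h.reachable, ?_⟩, fun h => hr (h u v)⟩, ?_⟩
    · dsimp only
      rw [ncard_edgeSet_glue, h5]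
    · exact h2.glue_sup_edge h4 ⟨u, hu⟩ ⟨v, hv⟩
    · exact setOf_glue_reachable h2 ⟨u, hu⟩
  · rintro ⟨⟨G₁, G₂⟩, q⟩ ⟨⟨G₁', G₂'⟩, q'⟩ - - he
    simp only [Prod.mk.injEq] at he
    obtain ⟨he, rfl⟩ := he
    obtain ⟨rfl, rfl⟩ := glue_injective he
    rfl
  · rintro ⟨H, u, v⟩ ⟨⟨⟨h1, h2, hu, hv, h5, h6⟩, h7⟩, h8⟩
    dsimp only at *
    have hor := reachable_or_of_sup_edge_connected h6
    have huv : ¬ H.Reachable u v := by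
      intro huv
      refine h7 ((connected_iff_exists_forall_reachable H).2 ⟨u, fun w => ?_⟩)
      exact (hor w).elim id fun h => huv.trans h
    have hcompl : {w | H.Reachable v w} = Sᶜ := by
      ext w
      rw [← h8]
      simp only [Set.mem_compl_iff, Set.mem_ofPred_eq]
      exact ⟨fun h h' => huv (h'.trans h.symm), fun h => (hor w).resolve_left h⟩
    have hglue : glue (H.induce S) (H.induce Sᶜ) = H := by
      refine glue_induce fun x hx y hy hxy => hy ?_
      rw [← h8] at hx ⊢
      exact Reachable.trans hx hxy.reachable
    refine ⟨((H.induce S, H.induce Sᶜ), u, v), ⟨⟨⟨fun a b hab => h1 _ _ hab, ?_⟩,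
      ⟨fun a b hab => h1 _ _ hab, ?_⟩, ?_⟩, ⟨?_, hu⟩, ?_, hv⟩, ?_⟩
    · have := connected_induce_setOf_reachable H u
      rwa [h8] at this
    · have := connected_induce_setOf_reachable H v
      rwa [hcompl] at this
    · dsimp only
      rw [← ncard_edgeSet_glue, hglue, h2]
    · rw [← h8]; exact .rfl
    · rw [← hcompl]; exact .rfl
    · simp only [hglue]

theorem ncard_connectedColoredPairs [Finite V] (c : V → Bool) (S : Set V) {m k : ℕ}
    (hm : m + 2 = Nat.card V + k) :
    (connectedColoredPairs c S m).ncard = ∑ i ∈ antidiagonal k,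
      (connectedColored (fun x : S => c x) i.1).ncard *
        (connectedColored (fun x : ↥Sᶜ => c x) i.2).ncard := by
  have hS : Nat.card S + Nat.card ↥Sᶜ = Nat.card V := by
    rw [Nat.card_coe_set_eq, Nat.card_coe_set_eq, Set.ncard_add_ncard_compl]
  -- Sort by the Betti numbers of the pieces; connectedness ensures that these subtractions do not
  -- truncate.
  rw [Set.ncard_eq_sum_ncard_fiber _ (fun q => (q.1.edgeSet.ncard + 1 - Nat.card S,
    q.2.edgeSet.ncard + 1 - Nat.card ↥Sᶜ)) (antidiagonal k)]
  · refine Finset.sum_congr rfl ?_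
    rintro ⟨k₁, k₂⟩ hk
    rw [mem_antidiagonal] at hk
    dsimp only at *
    rw [← Set.ncard_prod]
    congr 1
    ext ⟨G₁, G₂⟩
    simp only [connectedColoredPairs, connectedColored, Set.mem_ofPred_eq, Set.mem_prod,
      Prod.mk.injEq]
    constructor
    · rintro ⟨⟨⟨h1, h2⟩, ⟨h3, h4⟩, h5⟩, h6, h7⟩
      have h8 := h2.card_vert_le_card_edgeSet_add_one
      have h9 := h4.card_vert_le_card_edgeSet_add_one
      rw [Nat.card_coe_set_eq G₁.edgeSet] at h8
      rw [Nat.card_coe_set_eq G₂.edgeSet] at h9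
      exact ⟨⟨h1, h2, by omega⟩, h3, h4, by omega⟩
    · rintro ⟨⟨h1, h2, h5⟩, h3, h4, h6⟩
      exact ⟨⟨⟨h1, h2⟩, ⟨h3, h4⟩, by omega⟩, by omega, by omega⟩
  · rintro ⟨G₁, G₂⟩ ⟨⟨h1, h2⟩, ⟨h3, h4⟩, h5⟩
    have h8 := h2.card_vert_le_card_edgeSet_add_one
    have h9 := h4.card_vert_le_card_edgeSet_add_one
    dsimp only at *
    rw [Nat.card_coe_set_eq G₁.edgeSet] at h8
    rw [Nat.card_coe_set_eq G₂.edgeSet] at h9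
    rw [mem_antidiagonal]
    omega

theorem ncard_connectedColored_mul [Fintype V] [Fintype (Set V)] (c : V → Bool) {m k : ℕ}
    (hm : m + 2 = Nat.card V + k) :
    (connectedColored c k).ncard * (m + 1) =
      {G : SimpleGraph V | G.ProperlyColoredBy c ∧ G.Connected ∧ G.edgeSet.ncard = m}.ncard *
        ({u | c u = true}.ncard * {v | c v = false}.ncard - m) +
      ∑ S : Set V, (∑ i ∈ antidiagonal k,
        (connectedColored (fun x : S => c x) i.1).ncard *
          (connectedColored (fun x : ↥Sᶜ => c x) i.2).ncard) *
        ({u | u ∈ S ∧ c u = true}.ncard * {v | v ∈ Sᶜ ∧ c v = false}.ncard) := by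
  classical
  rw [← ncard_connectingPairs c hm, ← ncard_connectingPairs_connected]
  simp_rw [← ncard_connectedColoredPairs c _ hm, ← ncard_connectingPairs_fiber]
  rw [← Set.ncard_eq_sum_ncard_fiber _ _ _ (by simp)]
  rw [← Set.ncard_union_eq]
  · congr 1
    ext p
    simp only [Set.mem_union, Set.mem_ofPred_eq]
    tauto
  · rw [Set.disjoint_left]
    rintro p ⟨-, h⟩ ⟨-, h'⟩
    exact h' h

/-! ### Recursions for the numbers of connected bipartite graphs -/

theorem numConnBipartite_eq (r s k : ℕ) :
    numConnBipartite r s k =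
      (connectedColored (Sum.isLeft : Fin r ⊕ Fin s → Bool) k).ncard := by
  unfold numConnBipartite connectedColored
  congr 1
  ext G
  simp only [Set.mem_ofPred_eq, Nat.card_eq_fintype_card, Fintype.card_sum, Fintype.card_fin]
  refine and_congr_left fun _ => ⟨fun h a b hab => ?_, fun h a b hab => ?_⟩
  · have := h hab
    rcases a with a | a <;> rcases b with b | b <;> simp_all [completeBipartiteGraph]
  · have := h a b hab
    rcases a with a | a <;> rcases b with b | b <;> simp_all [completeBipartiteGraph]

theorem ncard_connectedColored {V : Type*} [Finite V] (c : V → Bool) (k : ℕ) :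
    (connectedColored c k).ncard =
      numConnBipartite {v | c v = true}.ncard {v | c v = false}.ncard k := by
  classical
  rw [numConnBipartite_eq]
  let e₁ : {v // c v = true} ≃ Fin {v | c v = true}.ncard := Finite.equivFinOfCardEq rfl
  let e₂ : {v // ¬ c v = true} ≃ Fin {v | c v = false}.ncard :=
    (Equiv.subtypeEquivRight (by simp)).trans
      (Finite.equivFinOfCardEq (α := {v // c v = false}) rfl)
  refine (ncard_connectedColored_congr
    ((Equiv.sumCongr e₁ e₂).symm.trans (Equiv.sumCompl _)) (fun v => ?_) k).symm
  obtain ⟨w, rfl⟩ := (Equiv.sumCongr e₁ e₂).surjective v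
  rcases w with w | w
  · simpa using w.2
  · simpa using w.2

/-- A subset of the disjoint union is a pair of subsets, and the summand sees only their sizes; this
yields the binomial convolution that matches `egf₂_mul`. -/
theorem sum_set_sum {M : Type*} [AddCommMonoid M] (r s : ℕ) [Fintype (Set (Fin r ⊕ Fin s))]
    (g : ℕ → ℕ → M) :
    ∑ S : Set (Fin r ⊕ Fin s), g {u | u ∈ S ∧ u.isLeft = true}.ncard
        {u | u ∈ S ∧ u.isLeft = false}.ncard =
      ∑ i ∈ Finset.range (r + 1), r.choose i •
        ∑ j ∈ Finset.range (s + 1), s.choose j • g i j := by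
  have hs : ∀ i, ∑ j ∈ Finset.range (s + 1), s.choose j • g i j =
      ∑ B : Finset (Fin s), g i B.card := fun i => by
    rw [← Finset.powerset_univ, Finset.sum_powerset_apply_card (g i), Finset.card_fin]
  simp_rw [hs]
  have hr := Finset.sum_powerset_apply_card
    (fun i => ∑ B : Finset (Fin s), g i B.card) (x := (Finset.univ : Finset (Fin r)))
  rw [Finset.card_fin, Finset.powerset_univ] at hr
  rw [← hr, ← Fintype.sum_prod_type']
  symm
  refine Fintype.sum_equiv
    ((Finset.sumEquiv (α := Fin r) (β := Fin s)).toEquiv.symm.trans Fintype.finsetEquivSet)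
    _ _ fun p => ?_
  have h : ((Finset.sumEquiv (α := Fin r) (β := Fin s)).toEquiv.symm.trans
      Fintype.finsetEquivSet) p = ((p.1.disjSum p.2 : Finset (Fin r ⊕ Fin s)) : Set _) := rfl
  rw [h]
  congr 1
  · rw [← Set.ncard_coe_finset, ← Set.ncard_image_of_injective _ Sum.inl_injective]
    congr 1
    ext (x | x) <;> simp
  · rw [← Set.ncard_coe_finset, ← Set.ncard_image_of_injective _ Sum.inr_injective]
    congr 1
    ext (x | x) <;> simp

theorem ncard_isLeft (r s : ℕ) : {u : Fin r ⊕ Fin s | u.isLeft = true}.ncard = r := by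
  have : {u : Fin r ⊕ Fin s | u.isLeft = true} = Set.range Sum.inl := by
    ext (x | x) <;> simp
  rw [this, ← Set.image_univ, Set.ncard_image_of_injective _ Sum.inl_injective]
  simp

theorem ncard_isRight (r s : ℕ) : {u : Fin r ⊕ Fin s | u.isLeft = false}.ncard = s := by
  have : {u : Fin r ⊕ Fin s | u.isLeft = false} = Set.range Sum.inr := by
    ext (x | x) <;> simp
  rw [this, ← Set.image_univ, Set.ncard_image_of_injective _ Sum.inr_injective]
  simp

theorem ncard_subtype_setOf {V : Type*} (S : Set V) (p : V → Prop) :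
    {x : S | p x}.ncard = {u | u ∈ S ∧ p u}.ncard := by
  rw [← Set.ncard_image_of_injective _ Subtype.val_injective]
  congr 1
  ext x
  simp [and_comm]

theorem ncard_compl_and {V : Type*} [Finite V] (S : Set V) (p : V → Prop) :
    {u | u ∈ Sᶜ ∧ p u}.ncard = {u | p u}.ncard - {u | u ∈ S ∧ p u}.ncard := by
  rw [← Set.ncard_sdiff (fun u hu => hu.2)]
  congr 1
  ext u
  simp only [Set.mem_ofPred_eq, Set.mem_sdiff, Set.mem_compl_iff]
  tauto

theorem numConnBipartite_mul {r s k m : ℕ} (hm : m + 2 = r + s + k) :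
    numConnBipartite r s k * (m + 1) =
      {G : SimpleGraph (Fin r ⊕ Fin s) | G.ProperlyColoredBy Sum.isLeft ∧ G.Connected ∧
        G.edgeSet.ncard = m}.ncard * (r * s - m) +
      ∑ i ∈ Finset.range (r + 1), r.choose i • ∑ j ∈ Finset.range (s + 1), s.choose j •
        ((∑ p ∈ antidiagonal k,
          numConnBipartite i j p.1 * numConnBipartite (r - i) (s - j) p.2) * (i * (s - j))) := by
  classical
  have h := ncard_connectedColored_mul (Sum.isLeft : Fin r ⊕ Fin s → Bool) (m := m) (k := k)
    (by simpa using hm)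
  rw [← numConnBipartite_eq, ncard_isLeft, ncard_isRight] at h
  rw [h, ← sum_set_sum r s fun i j => (∑ p ∈ antidiagonal k,
          numConnBipartite i j p.1 * numConnBipartite (r - i) (s - j) p.2) * (i * (s - j))]
  congr 1
  refine Finset.sum_congr rfl fun S _ => ?_
  have h1 := ncard_subtype_setOf S fun u => u.isLeft = true
  have h2 := ncard_subtype_setOf S fun u => u.isLeft = false
  have h3 := ncard_subtype_setOf Sᶜ fun u => u.isLeft = true
  have h4 := ncard_subtype_setOf Sᶜ fun u => u.isLeft = false
  simp_rw [ncard_connectedColored]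
  rw [ncard_compl_and, ncard_isLeft] at h3
  rw [ncard_compl_and, ncard_isRight] at h4
  rw [h1, h2, h3, h4, ncard_compl_and S fun u => u.isLeft = false, ncard_isRight]

theorem numConnBipartite_zero_zero (k : ℕ) : numConnBipartite 0 0 k = 0 := by
  rw [numConnBipartite, Set.ncard_eq_zero]
  ext G
  simp only [Set.mem_ofPred_eq, Set.mem_empty_iff_false, iff_false]
  rintro ⟨-, h, -⟩
  exact h.nonempty.elim fun x => x.elim Fin.elim0 Fin.elim0

theorem numConnBipartite_tree_mul {r s m : ℕ} (hm : m + 2 = r + s) :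
    numConnBipartite r s 0 * (m + 1) =
      ∑ i ∈ Finset.range (r + 1), r.choose i • ∑ j ∈ Finset.range (s + 1), s.choose j •
        (numConnBipartite i j 0 * numConnBipartite (r - i) (s - j) 0 * (i * (s - j))) := by
  rw [numConnBipartite_mul (k := 0) hm]
  -- Removing an edge from a tree disconnects it: `m` edges are too few to connect `m + 2` vertices.
  have h : {G : SimpleGraph (Fin r ⊕ Fin s) | G.ProperlyColoredBy Sum.isLeft ∧ G.Connected ∧
        G.edgeSet.ncard = m} = ∅ := by
    ext G
    simp only [Set.mem_ofPred_eq, Set.mem_empty_iff_false, iff_false]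
    rintro ⟨-, h1, h2⟩
    have h3 := h1.card_vert_le_card_edgeSet_add_one
    rw [Nat.card_coe_set_eq, h2] at h3
    simp only [Nat.card_eq_fintype_card, Fintype.card_sum, Fintype.card_fin] at h3
    omega
  simp [h]

theorem numConnBipartite_unicycle_mul {r s m : ℕ} (hm : m + 1 = r + s) :
    numConnBipartite r s 1 * (m + 1) = numConnBipartite r s 0 * (r * s - m) +
      ∑ i ∈ Finset.range (r + 1), r.choose i • ∑ j ∈ Finset.range (s + 1), s.choose j •
        ((numConnBipartite i j 0 * numConnBipartite (r - i) (s - j) 1 +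
          numConnBipartite i j 1 * numConnBipartite (r - i) (s - j) 0) * (i * (s - j))) := by
  rw [numConnBipartite_mul (k := 1) (m := m) (by omega), numConnBipartite_eq r s 0]
  have h : {G : SimpleGraph (Fin r ⊕ Fin s) | G.ProperlyColoredBy Sum.isLeft ∧ G.Connected ∧
      G.edgeSet.ncard = m} = connectedColored Sum.isLeft 0 := by
    ext G
    simp only [connectedColored, Set.mem_ofPred_eq, Nat.card_eq_fintype_card, Fintype.card_sum,
      Fintype.card_fin]
    refine and_congr_right fun _ => and_congr_right fun _ => ?_
    omega
  rw [h]
  rfl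

/-- A spanning tree of `K_{r,s}` has at most `r s` edges. -/
theorem numConnBipartite_eq_zero {r s : ℕ} (h : r * s + 1 < r + s) :
    numConnBipartite r s 0 = 0 := by
  rw [numConnBipartite_eq, Set.ncard_eq_zero]
  ext G
  simp only [connectedColored, Set.mem_ofPred_eq, Set.mem_empty_iff_false, iff_false]
  rintro ⟨h1, -, h3⟩
  have h4 : G.edgeSet.ncard ≤ r * s := by
    have h5 := Set.ncard_prod (s := {u : Fin r ⊕ Fin s | u.isLeft = true})
      (t := {u : Fin r ⊕ Fin s | u.isLeft = false})
    rw [ncard_isLeft, ncard_isRight] at h5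
    rw [← h1.ncard_edgeSet, ← h5]
    refine Set.ncard_le_ncard ?_
    rintro q ⟨hq1, hq2, -⟩
    exact ⟨hq1, hq2⟩
  simp only [Nat.card_eq_fintype_card, Fintype.card_sum, Fintype.card_fin] at h3
  omega

end SimpleGraph

/-! ### Two-variable exponential generating functions -/

namespace MvPowerSeries

/-- The two-variable exponential generating function of a family of rational numbers. -/
def egf₂ (A : ℕ → ℕ → ℚ) : MvPowerSeries (Fin 2) ℚ := fun d =>
  A (d 0) (d 1) / ((d 0).factorial * (d 1).factorial)

theorem coeff_egf₂ (A : ℕ → ℕ → ℚ) (d : Fin 2 →₀ ℕ) :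
    coeff d (egf₂ A) = A (d 0) (d 1) / ((d 0).factorial * (d 1).factorial) := rfl

theorem coeff_eulerOp (i : Fin 2) (f : MvPowerSeries (Fin 2) ℚ) (d : Fin 2 →₀ ℕ) :
    coeff d (eulerOp i f) = d i * coeff d f := by
  classical
  rw [eulerOp, X_def, coeff_monomial_mul, coeff_pderiv, one_mul]
  split_ifs with h
  · rw [tsub_add_cancel_of_le h, mul_comm]
    congr 1
    have := h i
    rw [Finsupp.single_eq_same] at this
    rw [Finsupp.tsub_apply, Finsupp.single_eq_same, Nat.cast_sub this]
    simp
  · rw [Finsupp.single_le_iff] at h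
    have : d i = 0 := by omega
    simp [this]

theorem eulerOp_zero_egf₂ (A : ℕ → ℕ → ℚ) :
    eulerOp 0 (egf₂ A) = egf₂ fun i j => i * A i j := by
  ext d
  rw [coeff_eulerOp, coeff_egf₂, coeff_egf₂, mul_div_assoc]

theorem eulerOp_one_egf₂ (A : ℕ → ℕ → ℚ) :
    eulerOp 1 (egf₂ A) = egf₂ fun i j => j * A i j := by
  ext d
  rw [coeff_eulerOp, coeff_egf₂, coeff_egf₂, mul_div_assoc]

theorem egf₂_add (A B : ℕ → ℕ → ℚ) :
    egf₂ A + egf₂ B = egf₂ fun i j => A i j + B i j := by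
  ext d
  rw [map_add, coeff_egf₂, coeff_egf₂, coeff_egf₂, add_div]

theorem egf₂_sub (A B : ℕ → ℕ → ℚ) :
    egf₂ A - egf₂ B = egf₂ fun i j => A i j - B i j := by
  ext d
  rw [map_sub, coeff_egf₂, coeff_egf₂, coeff_egf₂, sub_div]

theorem sum_antidiagonal_fin_two {M : Type*} [AddCommMonoid M] (d : Fin 2 →₀ ℕ)
    (g : ℕ → ℕ → ℕ → ℕ → M) :
    ∑ p ∈ antidiagonal d, g (p.1 0) (p.1 1) (p.2 0) (p.2 1) =
      ∑ i ∈ Finset.range (d 0 + 1), ∑ j ∈ Finset.range (d 1 + 1),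
        g i j (d 0 - i) (d 1 - j) := by
  rw [← Finset.sum_product']
  refine Finset.sum_nbij' (fun p => (p.1 0, p.1 1))
    (fun q => (Finsupp.equivFunOnFinite.symm ![q.1, q.2],
      Finsupp.equivFunOnFinite.symm ![d 0 - q.1, d 1 - q.2])) ?_ ?_ ?_ ?_ ?_
  · rintro ⟨p, q⟩ h
    rw [mem_antidiagonal] at h
    subst h
    simp
  · rintro ⟨i, j⟩ h
    simp only [Finset.mem_product, Finset.mem_range] at h
    rw [mem_antidiagonal]
    ext k
    fin_cases k <;> simp <;> omega
  · rintro ⟨p, q⟩ h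
    rw [mem_antidiagonal] at h
    subst h
    ext k <;> fin_cases k <;> simp
  · rintro ⟨i, j⟩ h
    simp
  · rintro ⟨p, q⟩ h
    rw [mem_antidiagonal] at h
    subst h
    simp

theorem egf₂_mul (A B : ℕ → ℕ → ℚ) :
    egf₂ A * egf₂ B = egf₂ fun r s => ∑ i ∈ Finset.range (r + 1), r.choose i •
      ∑ j ∈ Finset.range (s + 1), s.choose j • (A i j * B (r - i) (s - j)) := by
  classical
  ext d
  rw [coeff_mul, coeff_egf₂]
  simp_rw [coeff_egf₂]
  rw [sum_antidiagonal_fin_two d fun i j i' j' => A i j / (i.factorial * j.factorial) *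
    (B i' j' / (i'.factorial * j'.factorial)), Finset.sum_div]
  refine Finset.sum_congr rfl fun i hi => ?_
  rw [nsmul_eq_mul, Finset.mul_sum, Finset.sum_div]
  refine Finset.sum_congr rfl fun j hj => ?_
  rw [Finset.mem_range, Nat.lt_succ_iff] at hi hj
  rw [nsmul_eq_mul, Nat.cast_choose ℚ hi, Nat.cast_choose ℚ hj]
  have h1 := fun n : ℕ => (Nat.cast_ne_zero (R := ℚ)).2 n.factorial_ne_zero
  have := h1 i; have := h1 j; have := h1 (d 0); have := h1 (d 1)
  have := h1 (d 0 - i); have := h1 (d 1 - j)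
  field_simp

end MvPowerSeries

/-! ### The equations for trees and unicycles -/

open MvPowerSeries

theorem bipartiteEGF_eq (k : ℕ) :
    bipartiteEGF k = egf₂ fun r s => (numConnBipartite r s k : ℚ) := rfl

theorem tree_equation :
    treeEGFx + treeEGFy - treeEGF = treeEGFx * treeEGFy := by
  rw [treeEGFx, treeEGFy, treeEGF, bipartiteEGF_eq, eulerOp_zero_egf₂, eulerOp_one_egf₂,
    egf₂_add, egf₂_sub, egf₂_mul]
  congr 1
  ext r s
  by_cases hrs : 2 ≤ r + s
  · obtain ⟨m, hm⟩ := Nat.exists_eq_add_of_le' hrs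
    have h := SimpleGraph.numConnBipartite_tree_mul hm.symm
    have hm' : (m : ℚ) + 2 = r + s := by exact_mod_cast hm.symm
    simp only [smul_eq_mul] at h
    apply_fun (Nat.cast : ℕ → ℚ) at h
    push_cast at h
    have h0 : (r : ℚ) * (numConnBipartite r s 0) + s * (numConnBipartite r s 0) -
        numConnBipartite r s 0 = numConnBipartite r s 0 * (m + 1) := by
      linear_combination -(numConnBipartite r s 0 : ℚ) * hm'
    rw [h0, h]
    simp only [nsmul_eq_mul]
    refine Finset.sum_congr rfl fun i _ => ?_
    congr 1
    refine Finset.sum_congr rfl fun j _ => ?_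
    ring
  -- With at most one vertex there is no edge to remove; for exactly one vertex the factor r + s − 1
  -- on the left vanishes.
  · have : (r = 0 ∧ s = 0) ∨ (r = 1 ∧ s = 0) ∨ (r = 0 ∧ s = 1) := by omega
    rcases this with ⟨rfl, rfl⟩ | ⟨rfl, rfl⟩ | ⟨rfl, rfl⟩
    · simp [SimpleGraph.numConnBipartite_zero_zero]
    · simp
    · simp

theorem unicycle_equation :
    eulerOp 0 (bipartiteEGF 1) + eulerOp 1 (bipartiteEGF 1) =
      eulerOp 0 treeEGFy - (treeEGFx + treeEGFy - treeEGF) +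
        (treeEGFx * eulerOp 1 (bipartiteEGF 1) + eulerOp 0 (bipartiteEGF 1) * treeEGFy) := by
  rw [treeEGFx, treeEGFy, treeEGF, bipartiteEGF_eq, bipartiteEGF_eq]
  simp only [eulerOp_zero_egf₂, eulerOp_one_egf₂, egf₂_add, egf₂_sub, egf₂_mul]
  congr 1
  ext r s
  by_cases hrs : 1 ≤ r + s
  · obtain ⟨m, hm⟩ := Nat.exists_eq_add_of_le' hrs
    have h := SimpleGraph.numConnBipartite_unicycle_mul hm.symm
    have hm' : (m : ℚ) + 1 = r + s := by exact_mod_cast hm.symm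
    -- The subtraction truncates only when r s < m = r + s − 1, and then there are no spanning
    -- trees.
    have hsub : ((numConnBipartite r s 0 * (r * s - m) : ℕ) : ℚ) =
        numConnBipartite r s 0 * (r * s - m) := by
      by_cases hle : m ≤ r * s
      · push_cast [Nat.cast_sub hle]
        ring
      · rw [SimpleGraph.numConnBipartite_eq_zero (by omega)]
        simp
    simp only [smul_eq_mul] at h
    apply_fun (Nat.cast : ℕ → ℚ) at h
    rw [Nat.cast_add, hsub] at h
    push_cast at h
    have h0 : (r : ℚ) * (numConnBipartite r s 1) + s * (numConnBipartite r s 1) =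
        numConnBipartite r s 1 * (m + 1) := by
      linear_combination -(numConnBipartite r s 1 : ℚ) * hm'
    rw [h0, h]
    simp only [nsmul_eq_mul, ← Finset.sum_add_distrib, ← mul_add]
    congr 1
    · linear_combination -(numConnBipartite r s 0 : ℚ) * hm'
    refine Finset.sum_congr rfl fun i _ => ?_
    congr 1
    refine Finset.sum_congr rfl fun j _ => ?_
    ring
  · have : r = 0 ∧ s = 0 := by omega
    obtain ⟨rfl, rfl⟩ := this
    simp [SimpleGraph.numConnBipartite_zero_zero]

/-! ### Uniqueness for a linear differential equation, and the chain rule -/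

namespace MvPowerSeries

theorem coeff_mul_of_coeff_eq_zero {σ R : Type*} [CommSemiring R] {f g : MvPowerSeries σ R}
    (d : σ →₀ ℕ) (h : ∀ e, e.degree < d.degree → coeff e g = 0) :
    coeff d (f * g) = constantCoeff f * coeff d g := by
  classical
  rw [coeff_mul, Finset.sum_eq_single (0, d)]
  · simp
  · rintro ⟨a, b⟩ hab hne
    rw [mem_antidiagonal] at hab
    dsimp only at hab ⊢
    rw [h b, mul_zero]
    rw [← hab, map_add]
    have : a ≠ 0 := by
      rintro rfl
      simp_all
    have : a.degree ≠ 0 := by rwa [Ne, Finsupp.degree_eq_zero_iff]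
    omega
  · simp

/-- A solution `g` of the homogeneous linear equation `P x ∂g/∂x + Q y ∂g/∂y = R g`, where `P` and
`Q` have constant coefficient `1` and `R` has constant coefficient `ρ`, vanishes if its homogeneous
component of degree `ρ` does. -/
theorem eq_zero_of_eulerOp_eq {P Q R g : MvPowerSeries (Fin 2) ℚ} {ρ : ℕ}
    (hP : constantCoeff P = 1) (hQ : constantCoeff Q = 1) (hR : constantCoeff R = ρ)
    (h : P * eulerOp 0 g + Q * eulerOp 1 g = R * g)
    (hg : ∀ d : Fin 2 →₀ ℕ, d.degree = ρ → coeff d g = 0) : g = 0 := by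
  suffices H : ∀ n, ∀ d : Fin 2 →₀ ℕ, d.degree = n → coeff d g = 0 by
    ext d
    exact H _ d rfl
  intro n
  induction n using Nat.strong_induction_on with
  | _ n ih =>
    intro d hd
    by_cases hn : n = ρ
    · exact hg d (hd.trans hn)
    have hlow : ∀ e, e.degree < d.degree → coeff e g = 0 := fun e he => ih _ (hd ▸ he) e rfl
    have hE : ∀ i, ∀ e, e.degree < d.degree → coeff e (eulerOp i g) = 0 := fun i e he => by
      rw [coeff_eulerOp, hlow e he, mul_zero]
    -- As `g` vanishes below degree n, only the constant coefficients of `P`, `Q`, `R` contribute,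
    -- leaving (n − ρ)·g_d = 0.
    have := congrArg (coeff d) h
    rw [map_add, coeff_mul_of_coeff_eq_zero d (hE 0), coeff_mul_of_coeff_eq_zero d (hE 1),
      coeff_mul_of_coeff_eq_zero d hlow, hP, hQ, hR, coeff_eulerOp, coeff_eulerOp] at this
    have hdeg : (d 0 : ℚ) + d 1 = n := by
      rw [← hd, Finsupp.degree_eq_sum, Fin.sum_univ_two]
      push_cast
      rfl
    have hmul : ((n : ℚ) - ρ) * coeff d g = 0 := by
      rw [← hdeg]
      linear_combination this
    refine (mul_eq_zero.1 hmul).resolve_left ?_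
    rw [sub_eq_zero]
    exact_mod_cast hn

theorem eulerOp_add (i : Fin 2) (f g : MvPowerSeries (Fin 2) ℚ) :
    eulerOp i (f + g) = eulerOp i f + eulerOp i g := by
  simp [eulerOp, mul_add]

theorem eulerOp_sub (i : Fin 2) (f g : MvPowerSeries (Fin 2) ℚ) :
    eulerOp i (f - g) = eulerOp i f - eulerOp i g := by
  simp [eulerOp, mul_sub]

theorem eulerOp_mul (i : Fin 2) (f g : MvPowerSeries (Fin 2) ℚ) :
    eulerOp i (f * g) = f * eulerOp i g + g * eulerOp i f := by
  simp only [eulerOp, Derivation.leibniz, smul_eq_mul]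
  ring

theorem eulerOp_one (i : Fin 2) : eulerOp i 1 = 0 := by
  simp [eulerOp]

theorem eulerOp_comm (i j : Fin 2) (f : MvPowerSeries (Fin 2) ℚ) :
    eulerOp i (eulerOp j f) = eulerOp j (eulerOp i f) := by
  ext d
  simp only [coeff_eulerOp]
  ring

theorem constantCoeff_eulerOp (i : Fin 2) (f : MvPowerSeries (Fin 2) ℚ) :
    constantCoeff (eulerOp i f) = 0 := by
  simp [eulerOp]

/-- The chain rule for the partial derivatives of `f(a)`. -/
theorem pderiv_powerSeries_subst {σ R : Type*} [CommRing R] {a : MvPowerSeries σ R}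
    (ha : constantCoeff a = 0) (f : PowerSeries R) (i : σ) :
    pderiv R i (f.subst a) = (PowerSeries.derivative R f).subst a * pderiv R i a := by
  have ha' := PowerSeries.HasSubst.of_constantCoeff_zero ha
  suffices H : ∀ n, ∀ f : PowerSeries R, ∀ d : σ →₀ ℕ, d.degree < n →
      coeff d (pderiv R i (f.subst a) -
        (PowerSeries.derivative R f).subst a * pderiv R i a) = 0 by
    rw [← sub_eq_zero]
    ext d
    exact H _ f d (Nat.lt_succ_self _)
  intro n
  induction n with
  | zero => intro f d hd; omega
  | succ n ih =>
    intro f d hd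
    obtain ⟨c, g, hf⟩ : ∃ (c : R) (g : PowerSeries R), f = PowerSeries.X * g + PowerSeries.C c :=
      ⟨_, _, PowerSeries.eq_X_mul_shift_add_const f⟩
    have hstep : pderiv R i (f.subst a) - (PowerSeries.derivative R f).subst a * pderiv R i a =
        a * (pderiv R i (g.subst a) -
          (PowerSeries.derivative R g).subst a * pderiv R i a) := by
      rw [hf]
      simp only [map_add, Derivation.leibniz, PowerSeries.subst_add ha', PowerSeries.subst_mul ha',
        PowerSeries.subst_X ha', PowerSeries.subst_C, smul_eq_mul, PowerSeries.derivative_C,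
        PowerSeries.derivative_X, pderiv_C, mul_one, add_zero]
      ring
    rw [hstep, coeff_mul_of_coeff_eq_zero d fun e he => ih g e (by omega), ha, zero_mul]

theorem eulerOp_subst {a : MvPowerSeries (Fin 2) ℚ} (ha : constantCoeff a = 0)
    (f : PowerSeries ℚ) (i : Fin 2) :
    eulerOp i (f.subst a) = (PowerSeries.derivative ℚ f).subst a * eulerOp i a := by
  rw [eulerOp, eulerOp, pderiv_powerSeries_subst ha]
  ring

end MvPowerSeries

open MvPowerSeries

theorem eulerOp_treeEGFx_add :
    (1 - treeEGFy) * eulerOp 0 treeEGFx + (1 - treeEGFx) * eulerOp 0 treeEGFy = treeEGFx := by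
  have h := congrArg (eulerOp 0) tree_equation
  rw [eulerOp_sub, eulerOp_add, eulerOp_mul] at h
  have h2 : eulerOp 0 treeEGF = treeEGFx := rfl
  rw [h2] at h
  linear_combination h

theorem eulerOp_one_treeEGFx : eulerOp 1 treeEGFx = eulerOp 0 treeEGFy :=
  eulerOp_comm 1 0 treeEGF

theorem eulerOp_treeEGFy_add :
    (1 - treeEGFy) * eulerOp 0 treeEGFy + (1 - treeEGFx) * eulerOp 1 treeEGFy = treeEGFy := by
  have h := congrArg (eulerOp 1) tree_equation
  rw [eulerOp_sub, eulerOp_add, eulerOp_mul, eulerOp_one_treeEGFx] at h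
  have h2 : eulerOp 1 treeEGF = treeEGFy := rfl
  rw [h2] at h
  linear_combination h

theorem constantCoeff_treeEGFx : constantCoeff treeEGFx = 0 := constantCoeff_eulerOp _ _

theorem constantCoeff_treeEGFy : constantCoeff treeEGFy = 0 := constantCoeff_eulerOp _ _

theorem mixed_derivative_equation :
    eulerOp 0 treeEGFy * (1 - treeEGFx * treeEGFy) = treeEGFx * treeEGFy := by
  have hx := eulerOp_treeEGFx_add
  have hy := eulerOp_treeEGFy_add
  have hxy := congrArg (eulerOp 1) hx
  simp only [eulerOp_add, eulerOp_mul, eulerOp_sub, eulerOp_one, eulerOp_one_treeEGFx] at hxy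
  rw [eulerOp_comm 1 0 treeEGFx, eulerOp_one_treeEGFx] at hxy
  have hconst_x := constantCoeff_treeEGFx
  have hconst_y := constantCoeff_treeEGFy
  have hconst_t := constantCoeff_eulerOp 0 treeEGFy
  have htx := eulerOp_one_treeEGFx
  have hdeg : ∀ d : Fin 2 →₀ ℕ, d.degree = 1 →
      coeff d (eulerOp 0 treeEGFy * (1 - treeEGFx * treeEGFy) - treeEGFx * treeEGFy) = 0 := by
    intro d hd
    have hlow : ∀ {f : MvPowerSeries (Fin 2) ℚ}, constantCoeff f = 0 →
        ∀ e : Fin 2 →₀ ℕ, e.degree < d.degree → coeff e f = 0 := by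
      intro f hf e he
      rw [hd, Nat.lt_one_iff, Finsupp.degree_eq_zero_iff] at he
      rw [he, coeff_zero_eq_constantCoeff, hf]
    rw [map_sub, mul_comm, coeff_mul_of_coeff_eq_zero d (hlow hconst_t),
      coeff_mul_of_coeff_eq_zero d (hlow hconst_y), hconst_x, zero_mul, sub_zero,
      treeEGFy, coeff_eulerOp, coeff_eulerOp]
    rw [Finsupp.degree_eq_sum, Fin.sum_univ_two] at hd
    have : d 0 = 0 ∨ d 1 = 0 := by omega
    rcases this with h | h <;> simp [h]
  generalize treeEGFx = a at *
  generalize treeEGFy = b at *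
  rw [← sub_eq_zero]
  refine eq_zero_of_eulerOp_eq (ρ := 1) (P := (1 - b) * (1 - a) * (1 - b))
    (Q := (1 - b) * (1 - a) * (1 - a))
    (R := 2 * (1 - b) * (1 - a) * eulerOp 0 b + 2 * (1 - b) * (1 - a) - (1 - a * b))
    (by simp [hconst_x, hconst_y]) (by simp [hconst_x, hconst_y])
    (by simp [hconst_x, hconst_y, hconst_t, map_ofNat]; norm_num) ?_ hdeg
  simp only [eulerOp_mul, eulerOp_sub, eulerOp_one, htx]
  linear_combination (1 - b) * (1 - a) * (1 - a * b) * hxy +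
    ((1 - a * b) * (1 - a) * eulerOp 1 b - (1 - b) * (1 - a) * (eulerOp 0 b + 1) * b) * hx +
    ((1 - a * b) * (a - (1 - a) * eulerOp 0 b) -
      (1 - b) * (1 - a) * (eulerOp 0 b + 1) * a) * hy

theorem constantCoeff_treeEGFW : constantCoeff treeEGFW = 0 := by
  simp [treeEGFW, constantCoeff_treeEGFx]

theorem subst_unicycleSeries {w : MvPowerSeries (Fin 2) ℚ} (hw : constantCoeff w = 0) :
    PowerSeries.subst w unicycleSeries = (-(1 / 2) : ℚ) • (mvLog (1 - w) + w) := by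
  have hw' := PowerSeries.HasSubst.of_constantCoeff_zero hw
  have h : PowerSeries.HasSubst (-PowerSeries.X : PowerSeries ℚ) :=
    PowerSeries.HasSubst.of_constantCoeff_zero' (by simp)
  rw [unicycleSeries, PowerSeries.subst_smul hw', PowerSeries.subst_add hw',
    PowerSeries.subst_X hw', PowerSeries.logOf_eq, mvLog, sub_sub_cancel_left, sub_sub_cancel_left,
    PowerSeries.subst_comp_subst_apply h hw']
  congr 3
  rw [← PowerSeries.coe_substAlgHom hw', map_neg, PowerSeries.substAlgHom_X]

theorem one_sub_X_mul_derivative_unicycleSeries :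
    (1 - PowerSeries.X) * PowerSeries.derivative ℚ unicycleSeries =
      (1 / 2 : ℚ) • PowerSeries.X := by
  have h : PowerSeries.HasSubst (-PowerSeries.X : PowerSeries ℚ) :=
    PowerSeries.HasSubst.of_constantCoeff_zero' (by simp)
  have hlog : (1 + PowerSeries.X) * PowerSeries.derivative ℚ (PowerSeries.log ℚ) = 1 := by
    rw [PowerSeries.deriv_log]
    ext n
    rcases n with _ | n
    · simp
    · simp [add_mul, PowerSeries.coeff_succ_X_mul, PowerSeries.coeff_one, pow_succ]
  have hsub := congrArg (PowerSeries.substAlgHom h) hlog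
  rw [map_mul, map_add, map_one, PowerSeries.substAlgHom_X, PowerSeries.coe_substAlgHom] at hsub
  have hd : PowerSeries.derivative ℚ (PowerSeries.logOf (1 - PowerSeries.X)) =
      -(PowerSeries.derivative ℚ (PowerSeries.log ℚ)).subst (-PowerSeries.X : PowerSeries ℚ) := by
    rw [PowerSeries.logOf_eq, sub_sub_cancel_left, PowerSeries.derivative_subst h, map_neg,
      PowerSeries.derivative_X, mul_neg_one]
  have hhalf : ∀ f : PowerSeries ℚ, (-(1 / 2) : ℚ) • f = -((1 / 2 : ℚ) • f) := fun f => neg_smul _ _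
  rw [unicycleSeries, Derivation.map_smul, map_add, PowerSeries.derivative_X, hd, mul_smul_comm,
    hhalf, ← smul_neg]
  congr 1
  linear_combination hsub

theorem one_sub_mul_subst_derivative {w : MvPowerSeries (Fin 2) ℚ} (hw : constantCoeff w = 0) :
    (1 - w) * (PowerSeries.derivative ℚ unicycleSeries).subst w = (1 / 2 : ℚ) • w := by
  have h := PowerSeries.HasSubst.of_constantCoeff_zero hw
  have := congrArg (PowerSeries.substAlgHom h) one_sub_X_mul_derivative_unicycleSeries
  rwa [map_mul, map_sub, map_one, map_smul, PowerSeries.substAlgHom_X,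
    PowerSeries.coe_substAlgHom] at this

theorem constantCoeff_unicycleSeries : PowerSeries.constantCoeff unicycleSeries = 0 := by
  rw [unicycleSeries, PowerSeries.constantCoeff_smul, map_add,
    PowerSeries.constantCoeff_logOf (by simp)]
  simp

theorem bipartiteEGF_one_eq_subst :
    bipartiteEGF 1 = PowerSeries.subst treeEGFW unicycleSeries := by
  have hW := constantCoeff_treeEGFW
  have hf := one_sub_mul_subst_derivative hW
  have hhalf : (2 : MvPowerSeries (Fin 2) ℚ) * ((1 / 2 : ℚ) • treeEGFW) = treeEGFW := by
    rw [mul_smul_comm, two_mul, ← two_smul ℚ treeEGFW, smul_smul]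
    norm_num
  have hF := unicycle_equation
  have ht := tree_equation
  have hx := eulerOp_treeEGFx_add
  have hy := eulerOp_treeEGFy_add
  have hm := mixed_derivative_equation
  have hdeg : ∀ d : Fin 2 →₀ ℕ, d.degree = 0 →
      coeff d (bipartiteEGF 1 - PowerSeries.subst treeEGFW unicycleSeries) = 0 := by
    intro d hd
    rw [Finsupp.degree_eq_zero_iff] at hd
    rw [hd, map_sub, coeff_zero_eq_constantCoeff,
      PowerSeries.constantCoeff_subst_eq_zero hW _ constantCoeff_unicycleSeries,
      ← coeff_zero_eq_constantCoeff, bipartiteEGF_eq, coeff_egf₂]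
    simp [SimpleGraph.numConnBipartite_zero_zero]
  rw [← sub_eq_zero]
  refine eq_zero_of_eulerOp_eq (ρ := 0) (P := (1 - treeEGFW) * (1 - treeEGFy))
    (Q := (1 - treeEGFW) * (1 - treeEGFx)) (R := 0)
    (by simp [hW, constantCoeff_treeEGFy]) (by simp [hW, constantCoeff_treeEGFx])
    (by simp) ?_ hdeg
  simp only [eulerOp_sub, eulerOp_subst hW]
  generalize PowerSeries.subst treeEGFW (PowerSeries.derivative ℚ unicycleSeries) = g at *
  generalize (1 / 2 : ℚ) • treeEGFW = w at *
  simp only [treeEGFW, eulerOp_mul, eulerOp_one_treeEGFx] at *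
  generalize treeEGFx = a at *
  generalize treeEGFy = b at *
  linear_combination (1 - a * b) * hF + hm - (1 - a * b) * ht -
    (1 - a * b) * g * (b * hx + a * hy) - 2 * a * b * hf - a * b * hhalf

theorem proposition1p1 :
    -- `W` has no constant term, so that the substitutions `f₁(W)` and `log (1 - W)` make sense
    MvPowerSeries.constantCoeff treeEGFW = 0 ∧
    -- `F₁ = f₁(W)`
    bipartiteEGF 1 = PowerSeries.subst treeEGFW unicycleSeries ∧
    -- `F₁ = -(1/2) (log (1 - T_x T_y) + T_x T_y)`
    bipartiteEGF 1 =
      (-(1 / 2) : ℚ) • (mvLog (1 - treeEGFx * treeEGFy) + treeEGFx * treeEGFy) :=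
  ⟨constantCoeff_treeEGFW, bipartiteEGF_one_eq_subst,
    bipartiteEGF_one_eq_subst.trans (subst_unicycleSeries constantCoeff_treeEGFW)⟩
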